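/- For $t>\sqrt2$ there is exactly one real number $\beta=\beta(t)$ with $$1=\int_0^t \frac{u e^{-\beta u}}{1+e^{-\beta u}}\,du ,$$ and it satisfies $\beta(t)<\frac{\pi}{2\sqrt3}$. The function $\beta:(\sqrt2,\infty)\to\left(-\infty,\frac{\pi}{2\sqrt3}\right)$ so defined is differentiable with $\beta'(t)>0$. For $t>0$ and an integer $n\ge 0$ let $d_t(n)$ be the number of partitions of $n$ into distinct parts all of which are at most $t\sqrt n$ (equivalently, the coefficient of $x^n$ in $\prod_{1\le k\le t\sqrt n}(1+x^k)$). Let $\{\alpha\}=\alpha-\lfloor\alpha\rfloor$ denote the fractional part of $\alpha$, and for $t>\sqrt2$, with $\beta=\beta(t)$, put $$B(t)=2\beta+t\log\left(1+e^{-\beta t}\right),\qquad A_n(t)=\frac{e^{\beta t/2}+e^{-\beta t/2}}{2\left(1+e^{-\beta t}\right)^{\{t\sqrt n\}}}\sqrt{\frac{\beta'(t)}{\pi t}} .$$ Then for every fixed $t>\sqrt2$, as $n\to\infty$, $$d_t(n)\sim \frac{A_n(t)}{n^{3/4}}\,e^{B(t)\sqrt n},$$ that is, the ratio of the two sides tends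 to $1$. -/

import Mathlib

/-- The number `d_t(n)` of partitions of `n` into distinct parts, all of them at most `t √n`. -/
noncomputable def distinctCount (t : ℝ) (n : ℕ) : ℕ :=
  Nat.card {p : n.Partition // p.parts.Nodup ∧ ∀ k ∈ p.parts, (k : ℝ) ≤ t * √(n : ℝ)}

/-- The equation `1 = ∫₀ᵗ u e^{-bu} / (1 + e^{-bu}) du` that determines `b = β(t)`. -/
def IsBeta (t b : ℝ) : Prop :=
  1 = ∫ u in (0 : ℝ)..t, u * Real.exp (-b * u) / (1 + Real.exp (-b * u))

open Classical in
/-- The implicit function `β`: the solution `b` of `IsBeta t b`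
(and `0` for those `t` for which there is no solution). -/
noncomputable def beta (t : ℝ) : ℝ :=
  if h : ∃ b, IsBeta t b then h.choose else 0

/-- `B(t) = 2β + t log(1 + e^{-βt})`. -/
noncomputable def Bfun (t : ℝ) : ℝ :=
  2 * beta t + t * Real.log (1 + Real.exp (-beta t * t))

/-- `A_n(t)`; the exponent of the oscillating factor is the fractional part of `t √n`. -/
noncomputable def Afun (n : ℕ) (t : ℝ) : ℝ :=
  (Real.exp (beta t * t / 2) + Real.exp (-(beta t * t / 2))) /
      (2 * (1 + Real.exp (-beta t * t)) ^ Int.fract (t * √(n : ℝ))) *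
    √(deriv beta t / (Real.pi * t))

/-! Weight each set of integers in `[1, t√n]` by `x` to the power of its sum, where `x = e^{-b/√n}`.
This makes the indicators of the integers independent Bernoulli variables `ξ_k` of parameter `1/(1 +
e^{bk/√n})`, and coefficient extraction reads `d_t(n) x^n = ∏ (1 + x^k) · P(∑ k ξ_k = n)`
(`distinctCount_mul_exp_eq`, with the probability as a Fourier integral).

With `m = √n`, the mean of `∑ k ξ_k` is `m² ∫₀ᵗ u/(1+e^{bu}) du + O(m)` and its standard deviation
has order `m^{3/2}`. The equation for `β` places the mean on the target `n`, so the local limit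
theorem `tendsto_integral_charProd` gives a probability asymptotic to `(2π t³ V n^{3/2})^{-1/2}`,
with `V = scaledVar (βt)`. Its two ingredients are pointwise Gaussian convergence
(`tendsto_charProd`) and an integrable majorant on the whole circle (`exists_norm_charProd_le`).

The product is evaluated up to a factor `1 + o(1)` by Euler–Maclaurin applied to `log (1 + e^{-bu})`
(`tendsto_prod_one_add_exp`). The fractional part of `t√n` enters because the range of summation
stops short of `t√n`.

For `β` itself, `u = tv` turns the equation into `scaledMean (βt) = 1/t²`, where `scaledMean` is
strictly decreasing. The inverse function theorem then gives `β'` in terms of `V`, which is how `β'`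
enters the amplitude (`amplitude_eq`). -/

section DistinctPartitions

open Real MeasureTheory Filter Topology intervalIntegral

/-! ### Normalized mean and variance integrals. -/

/-- The normalized integral `∫₀¹ v / (1 + e^{cv}) dv`. -/
noncomputable def scaledMean (c : ℝ) : ℝ := ∫ v in (0 : ℝ)..1, v * sigmoid (-(c * v))

/-- The normalized variance `∫₀¹ v² e^{cv} / (1 + e^{cv})² dv`. -/
noncomputable def scaledVar (c : ℝ) : ℝ :=
  ∫ v in (0 : ℝ)..1, v ^ 2 * (sigmoid (-(c * v)) * (1 - sigmoid (-(c * v))))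

attribute [fun_prop] continuous_sigmoid

theorem exp_div_one_add_exp (x : ℝ) : exp x / (1 + exp x) = sigmoid x := by
  have h := exp_pos x
  rw [sigmoid_def, exp_neg]
  field_simp
  ring

theorem mul_exp_div_one_add_exp (b u : ℝ) :
    u * exp (-b * u) / (1 + exp (-b * u)) = u * sigmoid (-(b * u)) := by
  rw [mul_div_assoc, exp_div_one_add_exp, neg_mul]

theorem continuous_mul_sigmoid (c : ℝ) : Continuous fun v : ℝ => v * sigmoid (-(c * v)) := by
  fun_prop

theorem continuous_sq_mul_sigmoid (c : ℝ) :
    Continuous fun v : ℝ => v ^ 2 * (sigmoid (-(c * v)) * (1 - sigmoid (-(c * v)))) := by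
  fun_prop

theorem sigmoid_mul_one_sub_pos (x : ℝ) : 0 < sigmoid x * (1 - sigmoid x) :=
  mul_pos (sigmoid_pos x) (sub_pos.2 (sigmoid_lt_one x))

theorem scaledVar_pos (c : ℝ) : 0 < scaledVar c := by
  refine intervalIntegral_pos_of_pos_on ((continuous_sq_mul_sigmoid c).intervalIntegrable _ _)
    (fun v hv => ?_) one_pos
  exact mul_pos (pow_pos hv.1 2) (sigmoid_mul_one_sub_pos _)

theorem hasDerivAt_scaledMean (c : ℝ) : HasDerivAt scaledMean (-scaledVar c) c := by
  have key := hasDerivAt_integral_of_dominated_loc_of_deriv_le (μ := volume) (a := 0) (b := 1)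
    (F := fun c v : ℝ => v * sigmoid (-(c * v)))
    (F' := fun c v : ℝ => -(v ^ 2 * (sigmoid (-(c * v)) * (1 - sigmoid (-(c * v))))))
    (x₀ := c) (s := Set.univ) (bound := fun _ => 1) univ_mem
    (Eventually.of_forall fun x => (continuous_mul_sigmoid x).aestronglyMeasurable)
    ((continuous_mul_sigmoid c).intervalIntegrable _ _)
    (continuous_sq_mul_sigmoid c).neg.aestronglyMeasurable
    (ae_of_all _ fun v hv x _ => ?_) (by simp) (ae_of_all _ fun v hv x _ => ?_)
  · have := key.2
    rwa [intervalIntegral.integral_neg] at this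
  · rw [Set.uIoc_of_le zero_le_one] at hv
    have h1 := sigmoid_pos (-(x * v))
    have h2 := sigmoid_lt_one (-(x * v))
    rw [norm_neg, Real.norm_eq_abs, abs_of_nonneg (by
      exact mul_nonneg (sq_nonneg v) (sigmoid_mul_one_sub_pos _).le)]
    have : v ^ 2 ≤ 1 := pow_le_one₀ hv.1.le hv.2
    exact mul_le_one₀ this (sigmoid_mul_one_sub_pos _).le (by nlinarith)
  · have h1 : HasDerivAt (fun x : ℝ => -(x * v)) (-(1 * v)) x := ((hasDerivAt_id x).mul_const v).neg
    have h2 := ((hasDerivAt_sigmoid (-(x * v))).comp x h1).const_mul v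
    convert! h2 using 1
    ring

theorem continuous_scaledVar : Continuous scaledVar := by
  refine continuous_parametric_intervalIntegral_of_continuous'
    (f := fun c v : ℝ => v ^ 2 * (sigmoid (-(c * v)) * (1 - sigmoid (-(c * v))))) ?_ 0 1
  unfold Function.uncurry
  fun_prop

theorem hasStrictDerivAt_scaledMean (c : ℝ) : HasStrictDerivAt scaledMean (-scaledVar c) c :=
  hasStrictDerivAt_of_hasDerivAt_of_continuousAt (f' := fun c => -scaledVar c)
    (Eventually.of_forall hasDerivAt_scaledMean) continuous_scaledVar.neg.continuousAt

theorem scaledMean_strictAnti : StrictAnti scaledMean :=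
  strictAnti_of_hasDerivAt_neg hasDerivAt_scaledMean fun c => neg_neg_of_pos (scaledVar_pos c)

theorem continuous_scaledMean : Continuous scaledMean :=
  continuous_iff_continuousAt.2 fun c => (hasDerivAt_scaledMean c).continuousAt

/-- The symmetry `σ(-x) = 1 - σ(x)` transfers decay at `+∞` to the limit `1/2` at `-∞`; this `1/2`
is the source of the threshold `t > √2`. -/
theorem scaledMean_neg (c : ℝ) : scaledMean (-c) = 1 / 2 - scaledMean c := by
  have : ∀ v : ℝ, v * sigmoid (-(-c * v)) = v - v * sigmoid (-(c * v)) := fun v => by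
    rw [show -(-c * v) = -(-(c * v)) by ring, sigmoid_neg (-(c * v))]
    ring
  simp only [scaledMean, this]
  rw [integral_sub (by simp) ((continuous_mul_sigmoid c).intervalIntegrable _ _)]
  norm_num [integral_id]

theorem scaledMean_le {c : ℝ} (hc : 0 < c) : scaledMean c ≤ 1 / c := by
  have h : ∀ v ∈ Set.Icc (0 : ℝ) 1, v * sigmoid (-(c * v)) ≤ 1 / c := fun v hv => by
    have h1 : c * v ≤ exp (c * v) := by linarith [add_one_le_exp (c * v)]
    have h2 := exp_pos (c * v)
    rw [sigmoid_def, neg_neg, ← div_eq_mul_inv, div_le_div_iff₀ (by positivity) hc]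
    linarith
  have := integral_mono_on (zero_le_one' ℝ) ((continuous_mul_sigmoid c).intervalIntegrable _ _)
    (intervalIntegrable_const (μ := volume) (c := 1 / c)) h
  simpa using! this

theorem exists_scaledMean_eq {y : ℝ} (h0 : 0 < y) (h1 : y < 1 / 2) : ∃ c, scaledMean c = y := by
  have hc : 0 < 1 / (1 / 2 - y) := one_div_pos.2 (by linarith)
  have ha : y ≤ scaledMean (-(1 / (1 / 2 - y))) := by
    have := scaledMean_le hc
    rw [one_div_one_div] at this
    rw [scaledMean_neg]
    linarith
  have hb : scaledMean (1 / y) ≤ y := by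
    have := scaledMean_le (one_div_pos.2 h0)
    rwa [one_div_one_div] at this
  exact mem_range_of_exists_le_of_exists_ge continuous_scaledMean ⟨_, hb⟩ ⟨_, ha⟩

/-- Integration by parts relating the normalized mean and variance. -/
theorem two_mul_scaledMean_sub (c : ℝ) :
    2 * scaledMean c - c * scaledVar c = sigmoid (-c) := by
  have hd : ∀ v ∈ Set.uIcc (0 : ℝ) 1, HasDerivAt (fun v : ℝ => v ^ 2 * sigmoid (-(c * v)))
      (2 * (v * sigmoid (-(c * v)))
        - c * (v ^ 2 * (sigmoid (-(c * v)) * (1 - sigmoid (-(c * v)))))) v := fun v _ => by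
    have h1 : HasDerivAt (fun v : ℝ => -(c * v)) (-(c * 1)) v :=
      ((hasDerivAt_id v).const_mul c).neg
    have h2 := (hasDerivAt_pow 2 v).mul ((hasDerivAt_sigmoid (-(c * v))).comp v h1)
    convert! h2 using 1
    simp
    ring
  have h1 := (continuous_mul_sigmoid c).intervalIntegrable (μ := volume) 0 1
  have h2 := (continuous_sq_mul_sigmoid c).intervalIntegrable (μ := volume) 0 1
  have := integral_eq_sub_of_hasDerivAt hd ((h1.const_mul 2).sub (h2.const_mul c))
  rw [integral_sub (h1.const_mul 2) (h2.const_mul c), intervalIntegral.integral_const_mul,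
    intervalIntegral.integral_const_mul] at this
  simpa [scaledMean, scaledVar] using! this

theorem integral_mul_sigmoid (b : ℝ) {t : ℝ} (ht : 0 < t) :
    ∫ u in (0 : ℝ)..t, u * sigmoid (-(b * u)) = t ^ 2 * scaledMean (b * t) := by
  have := integral_comp_mul_left (a := 0) (b := 1) (fun u => u * sigmoid (-(b * u))) ht.ne'
  simp only [mul_zero, mul_one, smul_eq_mul] at this
  rw [scaledMean, eq_comm, ← intervalIntegral.integral_const_mul]
  rw [eq_comm, inv_mul_eq_iff_eq_mul₀ ht.ne', ← intervalIntegral.integral_const_mul] at this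
  rw [this]
  congr 1 with v
  rw [show b * (t * v) = b * t * v by ring]
  ring

theorem integral_sq_mul_sigmoid (b : ℝ) {t : ℝ} (ht : 0 < t) :
    ∫ u in (0 : ℝ)..t, u ^ 2 * (sigmoid (-(b * u)) * (1 - sigmoid (-(b * u)))) =
      t ^ 3 * scaledVar (b * t) := by
  have := integral_comp_mul_left (a := 0) (b := 1)
    (fun u => u ^ 2 * (sigmoid (-(b * u)) * (1 - sigmoid (-(b * u))))) ht.ne'
  simp only [mul_zero, mul_one, smul_eq_mul] at this
  rw [scaledVar, eq_comm, ← intervalIntegral.integral_const_mul]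
  rw [eq_comm, inv_mul_eq_iff_eq_mul₀ ht.ne', ← intervalIntegral.integral_const_mul] at this
  rw [this]
  congr 1 with v
  rw [show b * (t * v) = b * t * v by ring]
  ring

/-! ### Existence, uniqueness and derivative of `β`. -/

theorem isBeta_iff {t : ℝ} (ht : 0 < t) (b : ℝ) : IsBeta t b ↔ scaledMean (b * t) = 1 / t ^ 2 := by
  simp only [IsBeta, mul_exp_div_one_add_exp, integral_mul_sigmoid b ht]
  rw [eq_div_iff (by positivity), eq_comm, mul_comm]

theorem zero_lt_of_sqrt_two_lt {t : ℝ} (ht : √2 < t) : 0 < t := (sqrt_nonneg 2).trans_lt ht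

theorem isBeta_beta {t : ℝ} (ht : √2 < t) : IsBeta t (beta t) := by
  have h0 := zero_lt_of_sqrt_two_lt ht
  have hex : ∃ b, IsBeta t b := by
    have h2 : 2 < t ^ 2 := by
      rwa [sqrt_lt' h0] at ht
    obtain ⟨c, hc⟩ := exists_scaledMean_eq (y := 1 / t ^ 2) (by positivity)
      (one_div_lt_one_div_of_lt two_pos h2)
    exact ⟨c / t, by rwa [isBeta_iff h0, div_mul_cancel₀ _ h0.ne']⟩
  rw [beta, dif_pos hex]
  exact hex.choose_spec

theorem scaledMean_beta {t : ℝ} (ht : √2 < t) : scaledMean (beta t * t) = 1 / t ^ 2 :=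
  (isBeta_iff (zero_lt_of_sqrt_two_lt ht) _).1 (isBeta_beta ht)

theorem eq_beta_of_isBeta {t b : ℝ} (ht : √2 < t) (hb : IsBeta t b) : b = beta t := by
  have h0 := zero_lt_of_sqrt_two_lt ht
  rw [isBeta_iff h0, ← scaledMean_beta ht] at hb
  exact mul_right_cancel₀ h0.ne' (scaledMean_strictAnti.injective hb)

theorem integral_beta {t : ℝ} (ht : √2 < t) :
    ∫ u in (0 : ℝ)..t, u * sigmoid (-(beta t * u)) = 1 := by
  have h0 := zero_lt_of_sqrt_two_lt ht
  rw [integral_mul_sigmoid _ h0, scaledMean_beta ht]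
  field_simp

theorem hasDerivAt_beta {t : ℝ} (ht : √2 < t) :
    HasDerivAt beta (sigmoid (-(beta t * t)) / (t ^ 2 * scaledVar (beta t * t))) t := by
  have h0 := zero_lt_of_sqrt_two_lt ht
  set c := beta t * t with hc
  have hV := scaledVar_pos c
  have hne : -scaledVar c ≠ 0 := (neg_neg_of_pos hV).ne
  have hs := hasStrictDerivAt_scaledMean c
  have hval : scaledMean c = 1 / t ^ 2 := scaledMean_beta ht
  obtain ⟨g, hg, hr⟩ : ∃ g : ℝ → ℝ, HasDerivAt g (-scaledVar c)⁻¹ (1 / t ^ 2) ∧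
      ∀ᶠ x in 𝓝 (1 / t ^ 2), scaledMean (g x) = x := by
    rw [← hval]
    exact ⟨_, (hs.to_localInverse hne).hasDerivAt, hs.eventually_right_inverse hne⟩
  have hq : HasDerivAt (fun s : ℝ => 1 / s ^ 2) (-2 / t ^ 3) t := by
    have := (hasDerivAt_pow 2 t).inv (by positivity)
    simp only [one_div]
    convert! this using 1
    field_simp
    norm_num
  -- `beta` is a bare choice function; injectivity of `scaledMean` identifies it near `t` with the
  -- smooth local inverse.
  have hloc : ∀ᶠ s in 𝓝 t, beta s = g (1 / s ^ 2) / s := by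
    filter_upwards [hq.continuousAt.eventually hr, lt_mem_nhds ht] with s h1 h2
    have hs0 := zero_lt_of_sqrt_two_lt h2
    rw [eq_div_iff hs0.ne']
    rw [← scaledMean_beta h2] at h1 ⊢
    exact (scaledMean_strictAnti.injective h1).symm
  have hd := ((hg.comp t hq).div (hasDerivAt_id t) h0.ne').congr_of_eventuallyEq hloc
  convert! hd using 1
  have hlt := hloc.self_of_nhds
  rw [eq_div_iff h0.ne', ← hc] at hlt
  -- The quotient rule leaves the numerator `2 scaledMean c - c scaledVar c`, which integration by
  -- parts collapses to `sigmoid (-c)`.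
  have hp := two_mul_scaledMean_sub c
  rw [hval] at hp
  simp only [id, Function.comp, ← hlt, ← hp]
  field_simp

theorem deriv_beta {t : ℝ} (ht : √2 < t) :
    deriv beta t = sigmoid (-(beta t * t)) / (t ^ 2 * scaledVar (beta t * t)) :=
  (hasDerivAt_beta ht).deriv

theorem deriv_beta_pos {t : ℝ} (ht : √2 < t) : 0 < deriv beta t := by
  have h0 := zero_lt_of_sqrt_two_lt ht
  have hV := scaledVar_pos (beta t * t)
  have := sigmoid_pos (-(beta t * t))
  rw [deriv_beta ht]
  positivity

/-! ### The bound `β < π/(2√3)`. -/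

theorem hasSum_alternating_one_div_sq :
    HasSum (fun n : ℕ => (-1 : ℝ) ^ n * (1 / ((n : ℝ) + 1) ^ 2)) (π ^ 2 / 12) := by
  have h1 : HasSum (fun n : ℕ => 1 / ((n : ℝ) + 1) ^ 2) (π ^ 2 / 6) := by
    have := (hasSum_nat_add_iff' (f := fun n : ℕ => (1 : ℝ) / (n : ℝ) ^ 2) 1).2 hasSum_zeta_two
    simpa using this
  have h2 : HasSum (fun n : ℕ => 1 / ((2 * n + 1 : ℕ) + 1 : ℝ) ^ 2) (π ^ 2 / 24) := by
    have := h1.mul_left (1 / 4)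
    convert! this using 1
    · ext n
      push_cast
      field_simp
      ring
    · ring
  have hs : Summable (fun n : ℕ => 1 / ((2 * n : ℕ) + 1 : ℝ) ^ 2) :=
    h1.summable.comp_injective (i := fun n : ℕ => 2 * n) (mul_right_injective₀ two_ne_zero)
  have h3 : HasSum (fun n : ℕ => 1 / ((2 * n : ℕ) + 1 : ℝ) ^ 2) (π ^ 2 / 8) := by
    have := hs.hasSum.even_add_odd (f := fun n : ℕ => 1 / ((n : ℝ) + 1) ^ 2) h2
    have h4 := this.unique h1
    convert! hs.hasSum using 1
    linarith
  have := HasSum.even_add_odd (f := fun n : ℕ => (-1 : ℝ) ^ n * (1 / ((n : ℝ) + 1) ^ 2))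
    (m := π ^ 2 / 8) (m' := -(π ^ 2 / 24)) (by simpa using h3) (by simpa [pow_succ] using h2.neg)
  convert! this using 1
  ring

theorem integral_Ioi_mul_exp_neg (k : ℕ) :
    ∫ u in Set.Ioi (0 : ℝ), u * exp (-((k + 1 : ℝ) * u)) = 1 / ((k : ℝ) + 1) ^ 2 := by
  have := integral_rpow_mul_exp_neg_mul_Ioi (a := 2) (r := (k : ℝ) + 1) two_pos (by positivity)
  norm_num at this ⊢
  exact this

theorem integrableOn_mul_exp_neg (k : ℕ) :
    IntegrableOn (fun u : ℝ => u * exp (-((k + 1 : ℝ) * u))) (Set.Ioi 0) := by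
  -- A nonintegrable function has integral `0` by convention, against the positive value already
  -- computed.
  by_contra h
  have h2 := integral_Ioi_mul_exp_neg k
  rw [integral_undef h] at h2
  have : (0 : ℝ) < 1 / ((k : ℝ) + 1) ^ 2 := by positivity
  exact this.ne h2

/-- Expand `u/(1+e^u)` as an alternating geometric series. Partial sums with an odd number of terms
dominate the function pointwise and are nonnegative, so extending them to the half-line gives upper
bounds that converge to `π²/12`. -/
theorem integral_mul_sigmoid_neg_le {T : ℝ} (hT : 0 ≤ T) :
    ∫ u in (0 : ℝ)..T, u * sigmoid (-u) ≤ π ^ 2 / 12 := by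
  have hodd : Tendsto (fun m : ℕ => 2 * m + 1) atTop atTop :=
    tendsto_atTop_mono (fun m => by simp only [id]; omega) tendsto_id
  refine ge_of_tendsto' (hasSum_alternating_one_div_sq.tendsto_sum_nat.comp hodd) fun m => ?_
  have hint : ∀ k ∈ Finset.range (2 * m + 1), IntegrableOn
      (fun u : ℝ => (-1) ^ k * (u * exp (-((k + 1 : ℝ) * u)))) (Set.Ioi 0) := fun k _ =>
    (integrableOn_mul_exp_neg k).const_mul _
  have hsum : ∀ u : ℝ, ∑ k ∈ Finset.range (2 * m + 1), (-1) ^ k * (u * exp (-((k + 1 : ℝ) * u))) =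
      u * exp (-u) * ((1 + exp (-u) ^ (2 * m + 1)) / (1 + exp (-u))) := fun u => by
    have hx := exp_pos (-u)
    have hg := geom_sum_eq (x := -exp (-u)) (by linarith) (2 * m + 1)
    have : (1 + exp (-u) ^ (2 * m + 1)) / (1 + exp (-u)) =
        ∑ k ∈ Finset.range (2 * m + 1), (-exp (-u)) ^ k := by
      rw [hg, Odd.neg_pow ⟨m, rfl⟩, ← neg_div_neg_eq]
      congr 1 <;> ring
    rw [this, Finset.mul_sum]
    refine Finset.sum_congr rfl fun k _ => ?_
    rw [show -((k + 1 : ℝ) * u) = -u + k * (-u) by ring, exp_add, exp_nat_mul, neg_pow (exp (-u))]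
    ring
  have heq : ∑ k ∈ Finset.range (2 * m + 1), (-1 : ℝ) ^ k * (1 / ((k : ℝ) + 1) ^ 2) =
      ∫ u in Set.Ioi (0 : ℝ), ∑ k ∈ Finset.range (2 * m + 1),
        (-1) ^ k * (u * exp (-((k + 1 : ℝ) * u))) := by
    rw [integral_finsetSum _ hint]
    refine Finset.sum_congr rfl fun k _ => ?_
    rw [MeasureTheory.integral_const_mul, integral_Ioi_mul_exp_neg]
  have hI : IntegrableOn (fun u : ℝ => ∑ k ∈ Finset.range (2 * m + 1),
      (-1) ^ k * (u * exp (-((k + 1 : ℝ) * u)))) (Set.Ioi 0) := integrable_finsetSum _ hint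
  simp only [Function.comp, heq]
  rw [integral_of_le hT]
  have hsub : Set.Ioc 0 T ⊆ Set.Ioi (0 : ℝ) := fun u hu => hu.1
  refine le_trans (setIntegral_mono_on ?_ (hI.mono_set hsub) measurableSet_Ioc fun u hu => ?_)
    (setIntegral_mono_set hI ?_ hsub.eventuallyLE)
  · have : Continuous fun u : ℝ => u * sigmoid (-u) := by fun_prop
    exact this.integrableOn_Ioc
  · have hu0 : 0 < u := hu.1
    have hx := exp_pos (-u)
    have hxp := pow_pos hx (2 * m + 1)
    rw [hsum, ← exp_div_one_add_exp, mul_assoc]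
    refine mul_le_mul_of_nonneg_left ?_ hu0.le
    rw [← mul_div_assoc]
    gcongr
    nlinarith
  · refine (ae_restrict_iff' measurableSet_Ioi).2 (ae_of_all _ fun u hu => ?_)
    have hu0 : 0 < u := hu
    simp only [Pi.zero_apply, hsum]
    positivity

theorem scaledMean_lt {c : ℝ} (hc : 0 < c) : scaledMean c < π ^ 2 / (12 * c ^ 2) := by
  have hcont : Continuous fun u : ℝ => u * sigmoid (-u) := by fun_prop
  have h1 := integral_mul_sigmoid_neg_le (T := c + 1) (by linarith)
  rw [← integral_add_adjacent_intervals (hcont.intervalIntegrable 0 c)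
    (hcont.intervalIntegrable c (c + 1))] at h1
  -- The mass on `[c, c + 1]` makes the inequality strict.
  have h2 : 0 < ∫ u in c..(c + 1), u * sigmoid (-u) :=
    intervalIntegral_pos_of_pos_on (hcont.intervalIntegrable _ _)
      (fun u hu => mul_pos (hc.trans hu.1) (sigmoid_pos _)) (by linarith)
  have h3 := integral_mul_sigmoid 1 hc
  simp only [one_mul] at h3
  rw [h3] at h1
  rw [lt_div_iff₀ (by positivity)]
  linarith

theorem beta_lt {t : ℝ} (ht : √2 < t) : beta t < π / (2 * √3) := by
  have h0 := zero_lt_of_sqrt_two_lt ht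
  rcases le_or_gt (beta t) 0 with hb | hb
  · exact hb.trans_lt (by positivity)
  · have h := scaledMean_lt (mul_pos hb h0)
    rw [scaledMean_beta ht, div_lt_div_iff₀ (by positivity) (by positivity)] at h
    have h2 : 12 * beta t ^ 2 < π ^ 2 := by
      have : (12 * beta t ^ 2) * t ^ 2 < π ^ 2 * t ^ 2 := by nlinarith
      exact lt_of_mul_lt_mul_right this (by positivity)
    rw [lt_div_iff₀ (by positivity)]
    refine lt_of_pow_lt_pow_left₀ 2 pi_pos.le ?_
    rw [mul_pow, mul_pow, sq_sqrt (by norm_num)]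
    linarith

/-! ### Euler–Maclaurin summation. -/

/-- Integrate by parts against `x - μ`, with `μ` the midpoint. As `x - μ` has mean zero, `f'` may be
replaced by `f' - f'(μ)`, and the Lipschitz bound gives the cubic error. -/
theorem abs_integral_sub_trapezoid_le {f : ℝ → ℝ} (hf : ContDiff ℝ 2 f) {a b L : ℝ} (hab : a ≤ b)
    (hL : ∀ x ∈ Set.Icc a b, ∀ y ∈ Set.Icc a b, |deriv f x - deriv f y| ≤ L * |x - y|) :
    |(∫ x in a..b, f x) - (b - a) * ((f a + f b) / 2)| ≤ L * (b - a) ^ 3 := by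
  set μ := (a + b) / 2 with hμ
  have hc' : Continuous (deriv f) := hf.continuous_deriv (by norm_num)
  have hd : ∀ x, HasDerivAt f (deriv f x) x := fun x =>
    (hf.differentiable (by norm_num) x).hasDerivAt
  have hu : ∀ x, HasDerivAt (fun x : ℝ => x - μ) 1 x := fun x => (hasDerivAt_id x).sub_const μ
  have hparts := integral_mul_deriv_eq_deriv_mul (a := a) (b := b) (u := fun x => x - μ)
    (u' := fun _ => 1) (fun x _ => hu x) (fun x _ => hd x) (by simp)
    (hc'.intervalIntegrable _ _)
  have hzero : ∫ x in a..b, (x - μ) * deriv f μ = 0 := by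
    rw [intervalIntegral.integral_mul_const, intervalIntegral.integral_sub (by simp) (by simp)]
    simp only [integral_id, intervalIntegral.integral_const, smul_eq_mul, hμ]
    ring
  have hI1 : IntervalIntegrable (fun x => (x - μ) * deriv f x) volume a b :=
    Continuous.intervalIntegrable (by fun_prop) _ _
  have hI2 : IntervalIntegrable (fun x => (x - μ) * deriv f μ) volume a b :=
    Continuous.intervalIntegrable (by fun_prop) _ _
  have heq : (∫ x in a..b, f x) - (b - a) * ((f a + f b) / 2) =
      -∫ x in a..b, ((x - μ) * deriv f x - (x - μ) * deriv f μ) := by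
    rw [integral_sub hI1 hI2, hzero, hparts]
    simp only [one_mul, hμ]
    ring
  rw [heq, abs_neg, ← Real.norm_eq_abs]
  have hbound : ∀ x ∈ Set.uIoc a b, ‖(x - μ) * deriv f x - (x - μ) * deriv f μ‖ ≤
      L * (b - a) ^ 2 := fun x hx => by
    rw [Set.uIoc_of_le hab] at hx
    have hxm : |x - μ| ≤ b - a := by
      rw [abs_le, hμ]
      constructor <;> linarith [hx.1, hx.2]
    have h1 := hL x ⟨hx.1.le, hx.2⟩ μ ⟨by rw [hμ]; linarith, by rw [hμ]; linarith⟩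
    rw [← mul_sub, norm_mul, Real.norm_eq_abs, Real.norm_eq_abs]
    rcases eq_or_ne (x - μ) 0 with h0 | h0
    · have hL0 : 0 ≤ L * |b - a| :=
        (abs_nonneg _).trans (hL b ⟨hab, le_rfl⟩ a ⟨le_rfl, hab⟩)
      rw [abs_of_nonneg (sub_nonneg.2 hab)] at hL0
      rw [h0, abs_zero, zero_mul]
      nlinarith
    · have hL0 : 0 ≤ L := nonneg_of_mul_nonneg_left ((abs_nonneg _).trans h1) (abs_pos.2 h0)
      calc |x - μ| * |deriv f x - deriv f μ| ≤ |x - μ| * (L * |x - μ|) := by gcongr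
        _ = L * |x - μ| ^ 2 := by ring
        _ ≤ L * (b - a) ^ 2 := by gcongr
  refine (norm_integral_le_of_norm_le_const hbound).trans_eq ?_
  rw [abs_of_nonneg (sub_nonneg.2 hab)]
  ring

theorem abs_sum_sub_trapezoid_le {f : ℝ → ℝ} (hf : ContDiff ℝ 2 f) {t L h : ℝ} (hh : 0 ≤ h)
    (hL : ∀ x ∈ Set.Icc 0 t, ∀ y ∈ Set.Icc 0 t, |deriv f x - deriv f y| ≤ L * |x - y|)
    (N : ℕ) (hN : N * h ≤ t) :
    |h * ∑ k ∈ Finset.Icc 1 N, f (k * h) - (∫ x in (0 : ℝ)..(N * h), f x)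
      - h * ((f (N * h) - f 0) / 2)| ≤ N * (L * h ^ 3) := by
  induction N with
  | zero => simp
  | succ N ih =>
    push_cast at hN
    have ih := ih (by nlinarith)
    have hNh : (0 : ℝ) ≤ N * h := by positivity
    have hcell := abs_integral_sub_trapezoid_le hf (a := N * h) (b := (N + 1 : ℝ) * h) (L := L)
      (by nlinarith) fun x hx y hy =>
        hL x ⟨hNh.trans hx.1, hx.2.trans hN⟩ y ⟨hNh.trans hy.1, hy.2.trans hN⟩
    rw [show (N + 1 : ℝ) * h - N * h = h by ring] at hcell
    rw [Finset.sum_Icc_succ_top (by omega), ← integral_add_adjacent_intervals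
      (hf.continuous.intervalIntegrable 0 (N * h)) (hf.continuous.intervalIntegrable _ _)]
    push_cast
    rw [abs_le] at *
    constructor <;> nlinarith [ih.1, ih.2, hcell.1, hcell.2]

theorem exists_lipschitz_deriv {f : ℝ → ℝ} (hf : ContDiff ℝ 2 f) (t : ℝ) :
    ∃ L, ∀ x ∈ Set.Icc 0 t, ∀ y ∈ Set.Icc 0 t, |deriv f x - deriv f y| ≤ L * |x - y| := by
  have h1 : ContDiff ℝ 1 (deriv f) := (contDiff_succ_iff_deriv (n := 1).1 hf).2.2
  obtain ⟨L, hL⟩ := isCompact_Icc.exists_bound_of_continuousOn (s := Set.Icc 0 t)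
    (h1.continuous_deriv le_rfl).continuousOn
  exact ⟨L, fun x hx y hy => (convex_Icc 0 t).norm_image_sub_le_of_norm_deriv_le
    (fun z _ => h1.differentiable (by norm_num) z) hL hy hx⟩

/-- The Euler–Maclaurin formula to second order for a sum up to a moving endpoint. -/
theorem tendsto_sum_sub_integral {f : ℝ → ℝ} (hf : ContDiff ℝ 2 f) {t : ℝ} (ht : 0 < t) :
    Tendsto (fun m : ℝ => ∑ k ∈ Finset.Icc 1 ⌊t * m⌋₊, f (k / m) -
      (m * (∫ x in (0 : ℝ)..t, f x) - Int.fract (t * m) * f t + (f t - f 0) / 2))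
      atTop (𝓝 0) := by
  obtain ⟨L, hL⟩ := exists_lipschitz_deriv hf t
  have ha : Tendsto (fun m : ℝ => (⌊t * m⌋₊ : ℝ) / m) atTop (𝓝 t) :=
    tendsto_nat_floor_mul_div_atTop ht.le
  -- The trapezoidal sum ends at `⌊tm⌋/m`, not at `t`. Differentiating the integral in its endpoint
  -- turns this gap into `-{tm} f(t) + o(1)`.
  have hfract : ∀ᶠ m : ℝ in atTop, m * ((⌊t * m⌋₊ : ℝ) / m - t) = -Int.fract (t * m) := by
    filter_upwards [eventually_gt_atTop 0] with m hm
    have := Int.self_sub_floor (t * m)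
    rw [← natCast_floor_eq_intCast_floor (by positivity)] at this
    rw [← this]
    field_simp
    ring
  have h1 : Tendsto (fun m : ℝ => ∑ k ∈ Finset.Icc 1 ⌊t * m⌋₊, f (k / m) -
      m * (∫ x in (0 : ℝ)..((⌊t * m⌋₊ : ℝ) / m), f x) - (f ((⌊t * m⌋₊ : ℝ) / m) - f 0) / 2)
      atTop (𝓝 0) := by
    have hz : Tendsto (fun m : ℝ => |L| * t / m) atTop (𝓝 0) := tendsto_const_nhds.div_atTop tendsto_id
    refine squeeze_zero_norm' ?_ hz
    filter_upwards [eventually_gt_atTop 0] with m hm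
    have hfl : (⌊t * m⌋₊ : ℝ) ≤ t * m := Nat.floor_le (by positivity)
    have key := abs_sum_sub_trapezoid_le hf (h := m⁻¹) (by positivity) hL ⌊t * m⌋₊
      (by rwa [← div_eq_mul_inv, div_le_iff₀ hm])
    simp only [← div_eq_mul_inv] at key
    have hmul := mul_le_mul_of_nonneg_left key hm.le
    rw [← abs_of_pos hm, ← abs_mul, abs_of_pos hm] at hmul
    rw [Real.norm_eq_abs]
    calc _ = |m * (m⁻¹ * ∑ k ∈ Finset.Icc 1 ⌊t * m⌋₊, f (k / m)
          - (∫ x in (0 : ℝ)..((⌊t * m⌋₊ : ℝ) / m), f x)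
          - m⁻¹ * ((f ((⌊t * m⌋₊ : ℝ) / m) - f 0) / 2))| := by
          congr 1
          field_simp
      _ ≤ _ := hmul
      _ ≤ m * (⌊t * m⌋₊ * (|L| * m⁻¹ ^ 3)) := by
          gcongr
          exact le_abs_self L
      _ ≤ m * (t * m * (|L| * m⁻¹ ^ 3)) := by gcongr
      _ = |L| * t / m := by field_simp
  have h2 : Tendsto (fun m : ℝ => m * ((∫ x in (0 : ℝ)..((⌊t * m⌋₊ : ℝ) / m), f x) -
      (∫ x in (0 : ℝ)..t, f x) - ((⌊t * m⌋₊ : ℝ) / m - t) * f t)) atTop (𝓝 0) := by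
    have hd : HasDerivAt (fun a => ∫ x in (0 : ℝ)..a, f x) (f t) t :=
      integral_hasDerivAt_right (hf.continuous.intervalIntegrable _ _)
        hf.continuous.stronglyMeasurable.stronglyMeasurableAtFilter hf.continuous.continuousAt
    have ho := hd.isLittleO.comp_tendsto ha
    have hb : (fun m : ℝ => m * ((⌊t * m⌋₊ : ℝ) / m - t)) =O[atTop] fun _ => (1 : ℝ) := by
      refine Asymptotics.IsBigO.of_bound 1 ?_
      filter_upwards [hfract] with m hm
      rw [hm, norm_neg, Real.norm_eq_abs, abs_of_nonneg (Int.fract_nonneg _)]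
      simpa using! (Int.fract_lt_one _).le
    have := ((Asymptotics.isBigO_refl (fun m : ℝ => m) atTop).mul_isLittleO ho).trans_isBigO hb
    simpa [Function.comp_def] using! (Asymptotics.isLittleO_one_iff ℝ).1 this
  have h3 : Tendsto (fun m : ℝ => (f ((⌊t * m⌋₊ : ℝ) / m) - f t) / 2) atTop (𝓝 0) := by
    have := (((hf.continuous.tendsto t).comp ha).sub_const (f t)).div_const 2
    simpa [Function.comp_def] using this
  have := (h1.add h2).add h3
  simp only [add_zero] at this
  refine this.congr' ?_
  filter_upwards [hfract] with m hm
  linear_combination (-f t) * hm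

/-- The Riemann sum error is bounded, hence negligible against `√m`; this suffices for both the mean
and the variance. -/
theorem tendsto_sum_div {f : ℝ → ℝ} (hf : ContDiff ℝ 2 f) {t : ℝ} (ht : 0 < t) :
    Tendsto (fun m : ℝ => (∑ k ∈ Finset.Icc 1 ⌊t * m⌋₊, f (k / m) - m * ∫ x in (0 : ℝ)..t, f x) / √m)
      atTop (𝓝 0) := by
  have hb : (fun m : ℝ => ∑ k ∈ Finset.Icc 1 ⌊t * m⌋₊, f (k / m) - m * ∫ x in (0 : ℝ)..t, f x)
      =O[atTop] fun _ => (1 : ℝ) := by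
    have h1 := (tendsto_sum_sub_integral hf ht).isBigO_one ℝ
    have h2 : (fun m : ℝ => -Int.fract (t * m) * f t) =O[atTop] fun _ => (1 : ℝ) := by
      refine Asymptotics.IsBigO.of_bound |f t| (Eventually.of_forall fun m => ?_)
      rw [norm_mul, norm_neg, Real.norm_eq_abs, abs_of_nonneg (Int.fract_nonneg _)]
      have := (Int.fract_lt_one (t * m)).le
      simpa using mul_le_mul_of_nonneg_right this (abs_nonneg (f t))
    have h3 : (fun _ : ℝ => (f t - f 0) / 2) =O[atTop] fun _ => (1 : ℝ) :=
      Asymptotics.isBigO_const_const _ one_ne_zero _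
    refine ((h1.add h2).add h3).congr_left fun m => ?_
    ring
  have hs : Tendsto (fun m : ℝ => (√m)⁻¹) atTop (𝓝 0) := tendsto_sqrt_atTop.inv_tendsto_atTop
  have := hb.mul_isLittleO ((Asymptotics.isLittleO_one_iff ℝ).2 hs)
  simp only [mul_one, ← div_eq_mul_inv] at this
  exact (Asymptotics.isLittleO_one_iff ℝ).1 this

/-! ### Counting as a Fourier coefficient. -/

theorem distinctCount_eq_card {t : ℝ} (ht : 0 ≤ t) (n : ℕ) :
    distinctCount t n =
      ((Finset.Icc 1 ⌊t * √(n : ℝ)⌋₊).powerset.filter fun S => ∑ k ∈ S, k = n).card := by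
  have hle : ∀ k : ℕ, (k : ℝ) ≤ t * √(n : ℝ) ↔ k ≤ ⌊t * √(n : ℝ)⌋₊ := fun k =>
    (Nat.le_floor_iff (by positivity)).symm
  rw [distinctCount, ← Nat.card_eq_finsetCard]
  refine Nat.card_congr
    { toFun := fun p => ⟨⟨p.1.parts, p.2.1⟩, ?_⟩
      invFun := fun S => ⟨⟨S.1.val, fun {k} hk => ?_, ?_⟩, S.1.nodup, fun k hk => ?_⟩
      left_inv := fun p => rfl
      right_inv := fun S => rfl }
  · refine Finset.mem_filter.2 ⟨Finset.mem_powerset.2 fun k hk => ?_, ?_⟩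
    · exact Finset.mem_Icc.2 ⟨p.1.parts_pos hk, (hle k).1 (p.2.2 k hk)⟩
    · rw [Finset.sum, Multiset.map_id']
      exact p.1.parts_sum
  · exact (Finset.mem_Icc.1 (Finset.mem_powerset.1 (Finset.mem_filter.1 S.2).1 hk)).1
  · have h := (Finset.mem_filter.1 S.2).2
    rwa [Finset.sum, Multiset.map_id'] at h
  · exact (hle k).2
      (Finset.mem_Icc.1 (Finset.mem_powerset.1 (Finset.mem_filter.1 S.2).1 hk)).2

theorem prod_one_add_pow {R : Type*} [CommSemiring R] (s : Finset ℕ) (z : R) :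
    ∏ k ∈ s, (1 + z ^ k) = ∑ S ∈ s.powerset, z ^ ∑ k ∈ S, k := by
  rw [Finset.prod_one_add]
  exact Finset.sum_congr rfl fun S _ => Finset.prod_pow_eq_pow_sum S (fun k => k) z

theorem integral_exp_int_mul (j : ℤ) :
    ∫ θ in -π..π, Complex.exp ((j * θ : ℝ) * Complex.I) = if j = 0 then (2 * π : ℂ) else 0 := by
  split_ifs with h
  · simp [h]
    ring
  · have hc : (j : ℂ) * Complex.I ≠ 0 := mul_ne_zero (by exact_mod_cast h) Complex.I_ne_zero
    have h1 : ∀ θ : ℝ, ((j * θ : ℝ) : ℂ) * Complex.I = j * Complex.I * θ := fun θ => by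
      push_cast
      ring
    simp only [h1]
    rw [integral_exp_mul_complex hc]
    have h2 : (j : ℂ) * Complex.I * (π : ℝ) = (j : ℂ) * Complex.I * ((-π : ℝ) : ℂ)
        + j * (2 * π * Complex.I) := by
      push_cast
      ring
    rw [h2, Complex.exp_add, Complex.exp_int_mul_two_pi_mul_I]
    simp

/-- Expand the product over subsets; orthogonality of the exponentials keeps exactly the subsets of
sum `n`. -/
theorem integral_prod_one_add (s : Finset ℕ) (x : ℝ) (n : ℕ) :
    ∫ θ in -π..π, (∏ k ∈ s, (1 + (x : ℂ) ^ k * Complex.exp ((k * θ : ℝ) * Complex.I))) *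
        Complex.exp (-(n * θ : ℝ) * Complex.I) =
      2 * π * ((s.powerset.filter fun S => ∑ k ∈ S, k = n).card * (x : ℂ) ^ n) := by
  have hexp : ∀ θ : ℝ, (∏ k ∈ s, (1 + (x : ℂ) ^ k * Complex.exp ((k * θ : ℝ) * Complex.I))) *
      Complex.exp (-(n * θ : ℝ) * Complex.I) = ∑ S ∈ s.powerset, (x : ℂ) ^ (∑ k ∈ S, k) *
        Complex.exp (((((∑ k ∈ S, k : ℕ) : ℤ) - n : ℤ) * θ : ℝ) * Complex.I) := fun θ => by
    have h1 : ∀ k : ℕ, (x : ℂ) ^ k * Complex.exp ((k * θ : ℝ) * Complex.I) =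
        (x * Complex.exp (θ * Complex.I)) ^ k := fun k => by
      rw [mul_pow, ← Complex.exp_nat_mul]
      push_cast
      ring_nf
    simp only [h1]
    rw [prod_one_add_pow, Finset.sum_mul]
    refine Finset.sum_congr rfl fun S _ => ?_
    rw [mul_pow, ← Complex.exp_nat_mul, mul_assoc, ← Complex.exp_add]
    push_cast
    ring_nf
  simp only [hexp]
  rw [intervalIntegral.integral_finsetSum fun S _ => Continuous.intervalIntegrable (by fun_prop) _ _]
  simp only [intervalIntegral.integral_const_mul, integral_exp_int_mul]
  simp only [sub_eq_zero, Nat.cast_inj, mul_ite, mul_zero]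
  rw [← Finset.sum_filter, Finset.sum_congr rfl
    (g := fun _ => (x : ℂ) ^ n * (2 * π)) fun S hS => by rw [(Finset.mem_filter.1 hS).2]]
  rw [Finset.sum_const, nsmul_eq_mul]
  ring

/-- The characteristic function at `α` of a Bernoulli variable of parameter `p`. -/
noncomputable def bernoulliChar (p α : ℝ) : ℂ := 1 - p + p * Complex.exp (α * Complex.I)

/-- Normalizing each factor by its value at `z = 1` exhibits a Bernoulli generating function. -/
theorem one_add_exp_mul_eq (x : ℝ) (z : ℂ) :
    1 + (exp x : ℂ) * z = (1 + exp x : ℝ) * (1 - (sigmoid x : ℂ) + sigmoid x * z) := by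
  have h : (1 + exp x) * sigmoid x = exp x := by
    rw [← exp_div_one_add_exp]
    have := exp_pos x
    field_simp
  have hC : ((1 + exp x : ℝ) : ℂ) * sigmoid x = exp x := by exact_mod_cast h
  have h1 : ((1 + exp x : ℝ) : ℂ) = 1 + (exp x : ℂ) := by push_cast; ring
  linear_combination (1 - z) * hC - h1

/-- The characteristic function at `θ` of `∑ k ξ_k`, where `ξ_k` for `1 ≤ k ≤ t m` are independent
Bernoulli variables of parameter `1 / (1 + e^{bk/m})`. -/
noncomputable def charProd (b t m θ : ℝ) : ℂ :=
  ∏ k ∈ Finset.Icc 1 ⌊t * m⌋₊, bernoulliChar (sigmoid (-(b * (k / m)))) (k * θ)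

theorem distinctCount_mul_exp_eq {t : ℝ} (ht : 0 ≤ t) (b : ℝ) {n : ℕ} (hn : n ≠ 0) :
    2 * π * ((distinctCount t n : ℂ) * exp (-(b * √(n : ℝ)))) =
      (∏ k ∈ Finset.Icc 1 ⌊t * √(n : ℝ)⌋₊, (1 + exp (-(b * (k / √(n : ℝ))))) : ℝ) *
        ∫ θ in -π..π, charProd b t √(n : ℝ) θ * Complex.exp (-(n * θ : ℝ) * Complex.I) := by
  have hm : (0 : ℝ) < √(n : ℝ) := sqrt_pos.2 (by exact_mod_cast Nat.pos_of_ne_zero hn)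
  have hpow : ∀ k : ℕ, exp (-(b / √(n : ℝ))) ^ k = exp (-(b * (k / √(n : ℝ)))) := fun k => by
    rw [← exp_nat_mul]
    ring_nf
  have hn' : exp (-(b / √(n : ℝ))) ^ n = exp (-(b * √(n : ℝ))) := by
    rw [hpow]
    congr 3
    rw [div_eq_iff hm.ne', mul_self_sqrt (Nat.cast_nonneg n)]
  have key := integral_prod_one_add (Finset.Icc 1 ⌊t * √(n : ℝ)⌋₊) (exp (-(b / √(n : ℝ)))) n
  rw [← distinctCount_eq_card ht, ← Complex.ofReal_pow, hn'] at key
  rw [← key, ← intervalIntegral.integral_const_mul]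
  congr 1 with θ
  rw [← mul_assoc]
  congr 1
  rw [charProd, Complex.ofReal_prod, ← Finset.prod_mul_distrib]
  refine Finset.prod_congr rfl fun k _ => ?_
  rw [← Complex.ofReal_pow, hpow, one_add_exp_mul_eq, bernoulliChar]

/-! ### Decay of the characteristic function. -/

/-- The squared modulus is exactly `1 - 2p(1-p)(1 - cos α)`, and `1 + x ≤ e^x`. -/
theorem norm_bernoulliChar_le (p α : ℝ) :
    ‖bernoulliChar p α‖ ≤ exp (-(p * (1 - p) * (1 - cos α))) := by
  refine le_of_sq_le_sq ?_ (exp_pos _).le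
  have hre : (bernoulliChar p α).re = 1 - p + p * cos α := by
    simp [bernoulliChar, Complex.exp_ofReal_mul_I_re]
  have him : (bernoulliChar p α).im = p * sin α := by
    simp [bernoulliChar, Complex.exp_ofReal_mul_I_im]
  rw [← Complex.normSq_eq_norm_sq, Complex.normSq_apply, hre, him, ← exp_nat_mul]
  have := add_one_le_exp ((2 : ℕ) * -(p * (1 - p) * (1 - cos α)))
  push_cast at this ⊢
  refine le_trans (le_of_eq ?_) this
  linear_combination p ^ 2 * sin_sq_add_cos_sq α

theorem norm_bernoulliChar_le_one {p : ℝ} (h0 : 0 ≤ p) (h1 : p ≤ 1) (α : ℝ) :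
    ‖bernoulliChar p α‖ ≤ 1 := by
  refine (norm_bernoulliChar_le p α).trans (exp_le_one_iff.2 (neg_nonpos.2 ?_))
  exact mul_nonneg (mul_nonneg h0 (sub_nonneg.2 h1)) (sub_nonneg.2 (cos_le_one α))

theorem two_mul_sin_half_mul_sum_cos (θ : ℝ) (N : ℕ) :
    2 * sin (θ / 2) * ∑ k ∈ Finset.Icc 1 N, cos (k * θ) = sin ((N + 1 / 2) * θ) - sin (θ / 2) := by
  induction N with
  | zero => simp; ring_nf
  | succ N ih =>
    rw [Finset.sum_Icc_succ_top (by omega), mul_add, ih]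
    have h1 : ((N : ℝ) + 1 / 2) * θ = (N + 1) * θ - θ / 2 := by ring
    have h2 : (((N + 1 : ℕ) : ℝ) + 1 / 2) * θ = (N + 1) * θ + θ / 2 := by push_cast; ring
    rw [h1, h2, sin_sub, sin_add]
    push_cast
    ring

theorem sum_sq_Icc_ge (N : ℕ) : (N : ℝ) ^ 3 / 3 ≤ ∑ k ∈ Finset.Icc 1 N, (k : ℝ) ^ 2 := by
  induction N with
  | zero => simp
  | succ N ih =>
    rw [Finset.sum_Icc_succ_top (by omega)]
    push_cast
    have : (0 : ℝ) ≤ N := N.cast_nonneg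
    linear_combination ih + this

/-- All angles `kθ` stay in `[-π, π]`, where `1 - cos` is bounded below by a quadratic. -/
theorem sum_one_sub_cos_ge_of_le {θ : ℝ} {N : ℕ} (h : N * |θ| ≤ π) :
    2 / (3 * π ^ 2) * θ ^ 2 * N ^ 3 ≤ ∑ k ∈ Finset.Icc 1 N, (1 - cos (k * θ)) := by
  have hk : ∀ k ∈ Finset.Icc 1 N, 2 / π ^ 2 * θ ^ 2 * (k : ℝ) ^ 2 ≤ 1 - cos (k * θ) := fun k hk => by
    have hkN : (k : ℝ) ≤ N := by exact_mod_cast (Finset.mem_Icc.1 hk).2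
    have := cos_le_one_sub_mul_cos_sq (x := k * θ) (by
      rw [abs_mul, Nat.abs_cast]
      exact (mul_le_mul_of_nonneg_right hkN (abs_nonneg θ)).trans h)
    nlinarith
  refine le_trans ?_ (Finset.sum_le_sum hk)
  rw [← Finset.mul_sum]
  calc 2 / (3 * π ^ 2) * θ ^ 2 * N ^ 3 = 2 / π ^ 2 * θ ^ 2 * ((N : ℝ) ^ 3 / 3) := by
        field_simp
    _ ≤ _ := by
        gcongr
        exact sum_sq_Icc_ge N

/-- Here `N sin(|θ|/2) ≥ N|θ|/π ≥ 1`, so the Dirichlet kernel identity prevents the cosine sum from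
exceeding `N/2`. -/
theorem sum_one_sub_cos_ge_of_ge {θ : ℝ} {N : ℕ} (hN : N ≠ 0) (hθ : |θ| ≤ π) (h : π ≤ N * |θ|) :
    (N : ℝ) / 2 ≤ ∑ k ∈ Finset.Icc 1 N, (1 - cos (k * θ)) := by
  have habs : ∀ k : ℕ, cos (k * θ) = cos (k * |θ|) := fun k => by
    rw [← cos_abs (k * θ), abs_mul, Nat.abs_cast]
  simp only [habs]
  set x := |θ|
  have hx : 0 < x := pos_of_mul_pos_right (pi_pos.trans_le h) (Nat.cast_nonneg N)
  have hsin : x / π ≤ sin (x / 2) := by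
    have := mul_le_sin (x := x / 2) (by linarith) (by linarith)
    convert! this using 1
    field_simp
  have hs0 : 0 < x / π := by positivity
  have hN1 : 1 ≤ N * (x / π) := by
    rw [← mul_div_assoc, le_div_iff₀ pi_pos]
    linarith
  have key := two_mul_sin_half_mul_sum_cos x N
  have hle := sin_le_one (((N : ℝ) + 1 / 2) * x)
  rw [Finset.sum_sub_distrib]
  simp only [Finset.sum_const, Nat.card_Icc, add_tsub_cancel_right, nsmul_eq_mul, mul_one]
  set C := ∑ k ∈ Finset.Icc 1 N, cos (k * x)
  by_contra hcon
  have hC : (N : ℝ) / 2 < C := by linarith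
  have hNs : 1 ≤ N * sin (x / 2) := hN1.trans (by gcongr)
  nlinarith [hs0.trans_le hsin]

theorem exists_sigmoid_var_ge (b : ℝ) {t : ℝ} (ht : 0 < t) :
    ∃ c > 0, ∀ u ∈ Set.Icc 0 t, c ≤ sigmoid (-(b * u)) * (1 - sigmoid (-(b * u))) := by
  have hcont : Continuous fun u : ℝ => sigmoid (-(b * u)) * (1 - sigmoid (-(b * u))) := by fun_prop
  obtain ⟨u, _, hu⟩ := isCompact_Icc.exists_isMinOn (Set.nonempty_Icc.2 ht.le) hcont.continuousOn
  exact ⟨_, sigmoid_mul_one_sub_pos (-(b * u)), fun v hv => hu hv⟩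

theorem div_mem_Icc_of_mem {t m : ℝ} (ht : 0 < t) (hm : 0 < m) {k : ℕ}
    (hk : k ∈ Finset.Icc 1 ⌊t * m⌋₊) : (k : ℝ) / m ∈ Set.Icc 0 t := by
  refine ⟨by positivity, ?_⟩
  rw [div_le_iff₀ hm]
  exact (Nat.le_floor_iff (by positivity)).1 (Finset.mem_Icc.1 hk).2

theorem one_add_cube_le_exp {x : ℝ} (hx : 0 ≤ x) : 1 + x ^ 3 / 6 ≤ exp x := by
  refine le_trans ?_ (sum_le_exp_of_nonneg hx 4)
  simp [Finset.sum_range_succ, Nat.factorial]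
  nlinarith

/-- A bound for the scaled characteristic function, uniform in the scale `m`. -/
theorem exists_norm_charProd_le (b : ℝ) {t : ℝ} (ht : 0 < t) :
    ∃ a > 0, ∀ m : ℝ, 2 ≤ t * m → ∀ y : ℝ, |y| ≤ π * (m * √m) →
      ‖charProd b t m (y / (m * √m))‖ ≤ (1 + a * y ^ 2)⁻¹ := by
  obtain ⟨c, hc, hcv⟩ := exists_sigmoid_var_ge b ht
  set a₁ := c * (2 / (3 * π ^ 2)) * (t / 2) ^ 3 with ha₁
  set a₂ := (c * t / 4) ^ 3 / (6 * π ^ 2) with ha₂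
  have hp₁ : 0 < a₁ := by positivity
  have hp₂ : 0 < a₂ := by positivity
  refine ⟨min a₁ a₂, lt_min hp₁ hp₂, fun m htm y hy => ?_⟩
  have hm : 0 < m := pos_of_mul_pos_right (two_pos.trans_le htm) ht.le
  set w := m * √m with hw
  have hw0 : 0 < w := by positivity
  have hw2 : w ^ 2 = m ^ 3 := by
    rw [hw, mul_pow, sq_sqrt hm.le]
    ring
  set θ := y / w with hθ
  set N := ⌊t * m⌋₊ with hN
  have hNge : t * m / 2 ≤ N := by linarith [Nat.lt_floor_add_one (t * m)]
  have hN0 : N ≠ 0 := by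
    intro h0
    rw [h0] at hNge
    push_cast at hNge
    linarith
  have hθπ : |θ| ≤ π := by
    rw [hθ, abs_div, abs_of_pos hw0, div_le_iff₀ hw0]
    exact hy
  have hnorm : ‖charProd b t m θ‖ ≤ exp (-(c * ∑ k ∈ Finset.Icc 1 N, (1 - cos (k * θ)))) := by
    rw [charProd, norm_prod, Finset.mul_sum, ← Finset.sum_neg_distrib, exp_sum]
    refine Finset.prod_le_prod (fun _ _ => norm_nonneg _) fun k hk => ?_
    refine (norm_bernoulliChar_le _ _).trans ?_
    have := hcv _ (div_mem_Icc_of_mem ht hm hk)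
    have hcos := sub_nonneg.2 (cos_le_one (k * θ))
    gcongr
  refine hnorm.trans ?_
  rw [exp_neg]
  refine inv_anti₀ (by positivity) ?_
  -- For small `θ` the exponent is already at least a multiple of `y²`. Otherwise it is at least a
  -- multiple of `m` while `y² ≤ π² m³`, so the cubic term of the exponential series suffices.
  rcases le_total (N * |θ|) π with h | h
  · have h1 := sum_one_sub_cos_ge_of_le h
    have h2 : a₁ * y ^ 2 ≤ c * ∑ k ∈ Finset.Icc 1 N, (1 - cos (k * θ)) := by
      calc a₁ * y ^ 2 = c * (2 / (3 * π ^ 2) * θ ^ 2 * (t * m / 2) ^ 3) := by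
            rw [hθ, div_pow, hw2, ha₁]
            field_simp
        _ ≤ c * (2 / (3 * π ^ 2) * θ ^ 2 * N ^ 3) := by gcongr
        _ ≤ _ := by gcongr
    have h3 : min a₁ a₂ * y ^ 2 ≤ a₁ * y ^ 2 := by
      gcongr
      exact min_le_left _ _
    have := add_one_le_exp (c * ∑ k ∈ Finset.Icc 1 N, (1 - cos (k * θ)))
    linarith
  · have h1 := sum_one_sub_cos_ge_of_ge hN0 hθπ h
    have h2 : c * t / 4 * m ≤ c * ∑ k ∈ Finset.Icc 1 N, (1 - cos (k * θ)) := by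
      calc c * t / 4 * m = c * (t * m / 2 / 2) := by ring
        _ ≤ c * (N / 2) := by gcongr
        _ ≤ _ := by gcongr
    have hy2 : y ^ 2 ≤ π ^ 2 * m ^ 3 := by
      rw [← hw2, ← mul_pow, ← sq_abs y]
      gcongr
    have h3 : min a₁ a₂ * y ^ 2 ≤ (c * t / 4 * m) ^ 3 / 6 := by
      calc min a₁ a₂ * y ^ 2 ≤ a₂ * (π ^ 2 * m ^ 3) := by
            gcongr
            exact min_le_right _ _
        _ = (c * t / 4 * m) ^ 3 / 6 := by
            rw [ha₂]
            field_simp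
    have h4 := one_add_cube_le_exp (x := c * t / 4 * m) (by positivity)
    linarith [exp_le_exp.2 h2]

/-! ### Gaussian limit of the characteristic function. -/

/-- Replace the factors one at a time; every other factor has norm at most `1`. -/
theorem norm_prod_sub_prod_le_sum {ι : Type*} (s : Finset ι) (f g : ι → ℂ)
    (hf : ∀ i ∈ s, ‖f i‖ ≤ 1) (hg : ∀ i ∈ s, ‖g i‖ ≤ 1) :
    ‖∏ i ∈ s, f i - ∏ i ∈ s, g i‖ ≤ ∑ i ∈ s, ‖f i - g i‖ := by
  classical
  induction s using Finset.induction_on with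
  | empty => simp
  | insert i s hi ih =>
    have ih := ih (fun j hj => hf j (Finset.mem_insert_of_mem hj))
      fun j hj => hg j (Finset.mem_insert_of_mem hj)
    rw [Finset.prod_insert hi, Finset.prod_insert hi, Finset.sum_insert hi]
    have hP : ‖∏ j ∈ s, g j‖ ≤ 1 := by
      rw [norm_prod]
      exact Finset.prod_le_one (fun _ _ => norm_nonneg _)
        fun j hj => hg j (Finset.mem_insert_of_mem hj)
    have h1 := hf i (Finset.mem_insert_self i s)
    calc _ = ‖f i * (∏ j ∈ s, f j - ∏ j ∈ s, g j) + (f i - g i) * ∏ j ∈ s, g j‖ := by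
          congr 1
          ring
      _ ≤ ‖f i‖ * ‖∏ j ∈ s, f j - ∏ j ∈ s, g j‖ + ‖f i - g i‖ * ‖∏ j ∈ s, g j‖ := by
          rw [← norm_mul, ← norm_mul]
          exact norm_add_le _ _
      _ ≤ 1 * ∑ j ∈ s, ‖f j - g j‖ + ‖f i - g i‖ * 1 := by gcongr
      _ = _ := by ring

theorem norm_exp_mul_I_sub_taylor_le {x : ℝ} (hx : |x| ≤ 1) :
    ‖Complex.exp (x * Complex.I) - (1 + x * Complex.I - x ^ 2 / 2)‖ ≤ |x| ^ 3 := by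
  have hn : ‖(x : ℂ) * Complex.I‖ = |x| := by simp
  have h := Complex.exp_bound (x := x * Complex.I) (by rwa [hn]) (n := 3) (by norm_num)
  have hs : ∑ m ∈ Finset.range 3, ((x : ℂ) * Complex.I) ^ m / (m.factorial : ℂ) =
      1 + x * Complex.I - x ^ 2 / 2 := by
    simp [Finset.sum_range_succ, mul_pow, Nat.factorial]
    ring
  rw [hs, hn] at h
  refine h.trans (mul_le_of_le_one_right (by positivity) ?_)
  norm_num [Nat.factorial]

/-- The characteristic function at `α` of a centered Bernoulli variable of parameter `p`. -/
noncomputable def centeredChar (p α : ℝ) : ℂ :=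
  (1 - p) * Complex.exp ((-(p * α) : ℝ) * Complex.I) +
    p * Complex.exp (((1 - p) * α : ℝ) * Complex.I)

theorem bernoulliChar_eq (p α : ℝ) :
    bernoulliChar p α = Complex.exp ((p * α : ℝ) * Complex.I) * centeredChar p α := by
  rw [centeredChar, mul_add, mul_left_comm, ← Complex.exp_add, mul_left_comm, ← Complex.exp_add]
  rw [bernoulliChar]
  congr 2
  · push_cast
    ring_nf
    rw [Complex.exp_zero]
    ring
  · push_cast
    ring_nf

theorem norm_centeredChar_le_one {p : ℝ} (h0 : 0 ≤ p) (h1 : p ≤ 1) (α : ℝ) :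
    ‖centeredChar p α‖ ≤ 1 := by
  have h := norm_bernoulliChar_le_one h0 h1 α
  rwa [bernoulliChar_eq, norm_mul, Complex.norm_exp_ofReal_mul_I, one_mul] at h

/-- Centering kills the linear terms, and the quadratic ones agree because `(1-p)p² + p(1-p)² =
p(1-p)`. -/
theorem norm_centeredChar_sub_gaussian_le {p α : ℝ} (h0 : 0 ≤ p) (h1 : p ≤ 1) (hα : |α| ≤ 1) :
    ‖centeredChar p α - Complex.exp ((-(p * (1 - p) * α ^ 2 / 2) : ℝ))‖ ≤ 2 * |α| ^ 3 := by
  unfold centeredChar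
  have hq : 0 ≤ 1 - p := sub_nonneg.2 h1
  have ha : |-(p * α)| ≤ |α| := by
    rw [abs_neg, abs_mul, abs_of_nonneg h0]
    exact mul_le_of_le_one_left (abs_nonneg _) h1
  have hb : |(1 - p) * α| ≤ |α| := by
    rw [abs_mul, abs_of_nonneg hq]
    exact mul_le_of_le_one_left (abs_nonneg _) (by linarith)
  have e1 := norm_exp_mul_I_sub_taylor_le (ha.trans hα)
  have e2 := norm_exp_mul_I_sub_taylor_le (hb.trans hα)
  set s := p * (1 - p) * α ^ 2 / 2 with hs
  have hα2 : α ^ 2 ≤ 1 := by rw [← sq_abs]; exact pow_le_one₀ (abs_nonneg _) hα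
  have hs0 : 0 ≤ s := by positivity
  have hsα : s ≤ α ^ 2 := by
    have : p * (1 - p) ≤ 1 := by nlinarith
    rw [hs]
    nlinarith [sq_nonneg α]
  have e3 := Complex.norm_exp_sub_one_sub_id_le (x := ((-s : ℝ) : ℂ))
    (by rw [Complex.norm_real, norm_neg, Real.norm_eq_abs, abs_of_nonneg hs0]; linarith)
  rw [Complex.norm_real, norm_neg, Real.norm_eq_abs, abs_of_nonneg hs0] at e3
  have e3' : s ^ 2 ≤ |α| ^ 3 := by
    calc s ^ 2 ≤ (α ^ 2) ^ 2 := by gcongr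
      _ = |α| ^ 3 * |α| := by rw [← sq_abs α]; ring
      _ ≤ |α| ^ 3 := mul_le_of_le_one_right (by positivity) hα
  set E1 := Complex.exp ((-(p * α) : ℝ) * Complex.I)
  set E2 := Complex.exp (((1 - p) * α : ℝ) * Complex.I)
  set E3 := Complex.exp ((-s : ℝ))
  have hn1 : ‖(1 - p : ℂ)‖ = 1 - p := by
    rw [← Complex.ofReal_one, ← Complex.ofReal_sub, Complex.norm_real, Real.norm_eq_abs,
      abs_of_nonneg hq]
  have hn2 : ‖(p : ℂ)‖ = p := by rw [Complex.norm_real, Real.norm_eq_abs, abs_of_nonneg h0]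
  have hC : (s : ℂ) = p * (1 - p) * α ^ 2 / 2 := by rw [hs]; push_cast; ring
  calc _ = ‖(1 - p : ℂ) * (E1 - (1 + (-(p * α) : ℝ) * Complex.I - ((-(p * α) : ℝ) : ℂ) ^ 2 / 2)) +
        p * (E2 - (1 + ((1 - p) * α : ℝ) * Complex.I - (((1 - p) * α : ℝ) : ℂ) ^ 2 / 2)) -
        (E3 - 1 - (-s : ℝ))‖ := by
        congr 1
        push_cast
        rw [hC]
        ring
    _ ≤ (1 - p) * |α| ^ 3 + p * |α| ^ 3 + |α| ^ 3 := by
        refine (norm_sub_le _ _).trans (add_le_add ((norm_add_le _ _).trans (add_le_add ?_ ?_))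
          (e3.trans e3'))
        · rw [norm_mul, hn1]
          refine mul_le_mul_of_nonneg_left (e1.trans ?_) hq
          gcongr
        · rw [norm_mul, hn2]
          refine mul_le_mul_of_nonneg_left (e2.trans ?_) h0
          gcongr
    _ = 2 * |α| ^ 3 := by ring

theorem contDiff_sigmoid_neg_mul (b : ℝ) : ContDiff ℝ 2 fun u : ℝ => sigmoid (-(b * u)) :=
  (contDiff_sigmoid.of_le le_top).comp (contDiff_const.mul contDiff_id).neg

/-- The hypothesis `hb` cancels the order `m²` discrepancy between mean and target; what remains is
`O(m)`, below the scale `m^{3/2}`. -/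
theorem tendsto_mean (b : ℝ) {t : ℝ} (ht : 0 < t)
    (hb : ∫ u in (0 : ℝ)..t, u * sigmoid (-(b * u)) = 1) (y : ℝ) :
    Tendsto (fun m : ℝ => y / (m * √m) * (∑ k ∈ Finset.Icc 1 ⌊t * m⌋₊,
      sigmoid (-(b * (k / m))) * k - m ^ 2)) atTop (𝓝 0) := by
  have h := (tendsto_sum_div (contDiff_id.mul (contDiff_sigmoid_neg_mul b)) ht).const_mul y
  simp only [id, hb, mul_zero, mul_one] at h
  refine h.congr' ?_
  filter_upwards [eventually_gt_atTop 0] with m hm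
  have hs : ∑ k ∈ Finset.Icc 1 ⌊t * m⌋₊, sigmoid (-(b * (k / m))) * k =
      m * ∑ k ∈ Finset.Icc 1 ⌊t * m⌋₊, (k / m : ℝ) * sigmoid (-(b * (k / m))) := by
    rw [Finset.mul_sum]
    refine Finset.sum_congr rfl fun k _ => ?_
    field_simp
  have : 0 < √m := sqrt_pos.2 hm
  rw [hs]
  generalize ∑ k ∈ Finset.Icc 1 ⌊t * m⌋₊, (k / m : ℝ) * sigmoid (-(b * (k / m))) = S
  field_simp

theorem tendsto_var (b : ℝ) {t : ℝ} (ht : 0 < t) (y : ℝ) :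
    Tendsto (fun m : ℝ => ∑ k ∈ Finset.Icc 1 ⌊t * m⌋₊,
      -(sigmoid (-(b * (k / m))) * (1 - sigmoid (-(b * (k / m)))) * (k * (y / (m * √m))) ^ 2 / 2))
      atTop (𝓝 (-(t ^ 3 * scaledVar (b * t) / 2) * y ^ 2)) := by
  have hsm := contDiff_sigmoid_neg_mul b
  have h := tendsto_sum_div (f := fun u : ℝ =>
    u ^ 2 * (sigmoid (-(b * u)) * (1 - sigmoid (-(b * u)))))
    ((contDiff_id.pow 2).mul (hsm.mul (contDiff_const.sub hsm))) ht
  rw [integral_sq_mul_sigmoid b ht] at h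
  have hinv : Tendsto (fun m : ℝ => (√m)⁻¹) atTop (𝓝 0) := tendsto_sqrt_atTop.inv_tendsto_atTop
  have h2 := ((h.mul hinv).add_const (t ^ 3 * scaledVar (b * t))).const_mul (-(y ^ 2 / 2))
  rw [show -(y ^ 2 / 2) * (0 * 0 + t ^ 3 * scaledVar (b * t)) =
    -(t ^ 3 * scaledVar (b * t) / 2) * y ^ 2 by ring] at h2
  refine h2.congr' ?_
  filter_upwards [eventually_gt_atTop 0] with m hm
  have hs0 : 0 < √m := sqrt_pos.2 hm
  have hs : ∑ k ∈ Finset.Icc 1 ⌊t * m⌋₊,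
      -(sigmoid (-(b * (k / m))) * (1 - sigmoid (-(b * (k / m)))) * (k * (y / (m * √m))) ^ 2 / 2) =
      -(y ^ 2 / 2) / m * ∑ k ∈ Finset.Icc 1 ⌊t * m⌋₊,
        (k / m : ℝ) ^ 2 * (sigmoid (-(b * (k / m))) * (1 - sigmoid (-(b * (k / m))))) := by
    rw [Finset.mul_sum]
    refine Finset.sum_congr rfl fun k _ => ?_
    rw [mul_pow (k : ℝ), div_pow y, mul_pow m, sq_sqrt hm.le]
    field_simp
  rw [hs]
  set S := ∑ k ∈ Finset.Icc 1 ⌊t * m⌋₊,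
    (k / m : ℝ) ^ 2 * (sigmoid (-(b * (k / m))) * (1 - sigmoid (-(b * (k / m)))))
  have : (S - m * (t ^ 3 * scaledVar (b * t))) / √m * (√m)⁻¹ =
      (S - m * (t ^ 3 * scaledVar (b * t))) / m := by
    rw [← div_eq_mul_inv, div_div, mul_self_sqrt hm.le]
  rw [this]
  field_simp
  ring

theorem tendsto_prod_centeredChar (b : ℝ) {t : ℝ} (ht : 0 < t) (y : ℝ) :
    Tendsto (fun m : ℝ => ∏ k ∈ Finset.Icc 1 ⌊t * m⌋₊,
      centeredChar (sigmoid (-(b * (k / m)))) (k * (y / (m * √m)))) atTop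
      (𝓝 (Complex.exp ((-(t ^ 3 * scaledVar (b * t) / 2) * y ^ 2 : ℝ)))) := by
  have hgauss : Tendsto (fun m : ℝ => ∏ k ∈ Finset.Icc 1 ⌊t * m⌋₊,
      Complex.exp ((-(sigmoid (-(b * (k / m))) * (1 - sigmoid (-(b * (k / m)))) *
        (k * (y / (m * √m))) ^ 2 / 2) : ℝ))) atTop
      (𝓝 (Complex.exp ((-(t ^ 3 * scaledVar (b * t) / 2) * y ^ 2 : ℝ)))) := by
    have h := (Complex.continuous_exp.comp Complex.continuous_ofReal).tendsto _ |>.comp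
      (tendsto_var b ht y)
    refine h.congr fun m => ?_
    simp only [Function.comp, Complex.ofReal_sum, Complex.exp_sum]
  have hinv : Tendsto (fun m : ℝ => (√m)⁻¹) atTop (𝓝 0) := tendsto_sqrt_atTop.inv_tendsto_atTop
  have hdiff : Tendsto (fun m : ℝ => ∏ k ∈ Finset.Icc 1 ⌊t * m⌋₊,
      centeredChar (sigmoid (-(b * (k / m)))) (k * (y / (m * √m))) -
      ∏ k ∈ Finset.Icc 1 ⌊t * m⌋₊,
      Complex.exp ((-(sigmoid (-(b * (k / m))) * (1 - sigmoid (-(b * (k / m)))) *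
        (k * (y / (m * √m))) ^ 2 / 2) : ℝ))) atTop (𝓝 0) := by
    -- At most `tm` factors are replaced, each at cost `O(m^{-3/2})`.
    have hz : Tendsto (fun m : ℝ => 2 * t * (t * |y|) ^ 3 * (√m)⁻¹) atTop (𝓝 0) := by
      simpa using hinv.const_mul (2 * t * (t * |y|) ^ 3)
    have hsmall : ∀ᶠ m : ℝ in atTop, t * |y| * (√m)⁻¹ ≤ 1 := by
      have : Tendsto (fun m : ℝ => t * |y| * (√m)⁻¹) atTop (𝓝 0) := by
        simpa using hinv.const_mul (t * |y|)
      exact this.eventually (ge_mem_nhds one_pos)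
    refine squeeze_zero_norm' ?_ hz
    filter_upwards [eventually_gt_atTop 0, hsmall] with m hm hle
    have hs0 : 0 < √m := sqrt_pos.2 hm
    have hα : ∀ k ∈ Finset.Icc 1 ⌊t * m⌋₊, |(k : ℝ) * (y / (m * √m))| ≤ t * |y| * (√m)⁻¹ :=
      fun k hk => by
        have := (div_mem_Icc_of_mem ht hm hk).2
        calc |(k : ℝ) * (y / (m * √m))| = k / m * |y| * (√m)⁻¹ := by
              rw [abs_mul, abs_div, Nat.abs_cast, abs_of_pos (mul_pos hm hs0)]
              field_simp
          _ ≤ _ := by gcongr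
    refine (norm_prod_sub_prod_le_sum _ _ _
      (fun k _ => norm_centeredChar_le_one (sigmoid_nonneg _) (sigmoid_le_one _) _)
      fun k _ => ?_).trans ?_
    · rw [← Complex.ofReal_exp, Complex.norm_real, Real.norm_eq_abs, abs_of_pos (exp_pos _),
        exp_le_one_iff, neg_nonpos]
      have := sigmoid_mul_one_sub_pos (-(b * (k / m)))
      positivity
    · calc _ ≤ ∑ k ∈ Finset.Icc 1 ⌊t * m⌋₊, 2 * (t * |y| * (√m)⁻¹) ^ 3 := by
            refine Finset.sum_le_sum fun k hk => ?_
            refine (norm_centeredChar_sub_gaussian_le (sigmoid_nonneg _) (sigmoid_le_one _)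
              ((hα k hk).trans hle)).trans ?_
            have := hα k hk
            gcongr
        _ = ⌊t * m⌋₊ * (2 * (t * |y| * (√m)⁻¹) ^ 3) := by simp
        _ ≤ t * m * (2 * (t * |y| * (√m)⁻¹) ^ 3) := by
            gcongr
            exact Nat.floor_le (by positivity)
        _ = 2 * t * (t * |y|) ^ 3 * (m * ((√m)⁻¹ * (√m)⁻¹)) * (√m)⁻¹ := by ring
        _ = _ := by
            rw [← mul_inv, mul_self_sqrt hm.le, mul_inv_cancel₀ hm.ne', mul_one]
  simpa using! hdiff.add hgauss

/-- The product splits into a phase carrying the mean, which cancels against the target phase in the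
limit, and the centered product. -/
theorem tendsto_charProd (b : ℝ) {t : ℝ} (ht : 0 < t)
    (hb : ∫ u in (0 : ℝ)..t, u * sigmoid (-(b * u)) = 1) (y : ℝ) :
    Tendsto (fun m : ℝ => charProd b t m (y / (m * √m)) *
      Complex.exp (-(m ^ 2 * (y / (m * √m)) : ℝ) * Complex.I)) atTop
      (𝓝 (Complex.exp ((-(t ^ 3 * scaledVar (b * t) / 2) * y ^ 2 : ℝ)))) := by
  have hcont : Continuous fun x : ℝ => Complex.exp (x * Complex.I) := by fun_prop
  have h1 := (hcont.tendsto 0).comp (tendsto_mean b ht hb y)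
  have h2 := h1.mul (tendsto_prod_centeredChar b ht y)
  simp only [Complex.ofReal_zero, zero_mul, Complex.exp_zero, one_mul] at h2
  refine h2.congr fun m => ?_
  simp only [charProd, bernoulliChar_eq, Finset.prod_mul_distrib, Function.comp]
  rw [← Complex.exp_sum, mul_right_comm, ← Complex.exp_add]
  congr 2
  rw [← Finset.sum_mul, ← Complex.ofReal_sum, ← add_mul, ← Complex.ofReal_neg, ← Complex.ofReal_add]
  congr 2
  rw [mul_sub, Finset.mul_sum]
  have : ∀ k : ℕ, y / (m * √m) * (sigmoid (-(b * (k / m))) * k) =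
    sigmoid (-(b * (k / m))) * (k * (y / (m * √m))) := fun k => by ring
  simp only [this]
  ring

theorem continuous_charProd (b t m : ℝ) : Continuous (charProd b t m) := by
  unfold charProd bernoulliChar
  fun_prop

theorem integrable_inv_one_add_mul_sq {a : ℝ} (ha : 0 < a) :
    Integrable fun y : ℝ => (1 + a * y ^ 2)⁻¹ := by
  have := integrable_inv_one_add_sq.comp_mul_left' (sqrt_pos.2 ha).ne'
  simpa only [mul_pow, sq_sqrt ha.le] using this

/-! ### Local limit theorem. -/

/-- The local limit theorem for `∑ k ξ_k`. -/
theorem tendsto_integral_charProd (b : ℝ) {t : ℝ} (ht : 0 < t)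
    (hb : ∫ u in (0 : ℝ)..t, u * sigmoid (-(b * u)) = 1) :
    Tendsto (fun m : ℝ => ((m * √m : ℝ) : ℂ) *
      ∫ θ in -π..π, charProd b t m θ * Complex.exp (-(m ^ 2 * θ : ℝ) * Complex.I)) atTop
      (𝓝 ((√(2 * π / (t ^ 3 * scaledVar (b * t))) : ℝ) : ℂ)) := by
  obtain ⟨a, ha, hbound⟩ := exists_norm_charProd_le b ht
  set F : ℝ → ℝ → ℂ := fun m θ =>
    charProd b t m θ * Complex.exp (-(m ^ 2 * θ : ℝ) * Complex.I) with hF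
  have hFc : ∀ m, Continuous (F m) := fun m => by
    have := continuous_charProd b t m
    simp only [hF]
    fun_prop
  have hnorm : ∀ m θ, ‖F m θ‖ = ‖charProd b t m θ‖ := fun m θ => by
    simp only [hF]
    rw [norm_mul, ← Complex.ofReal_neg, Complex.norm_exp_ofReal_mul_I, mul_one]
  -- Substituting `θ = y / m^{3/2}` and extending by zero puts all the integrals on the fixed domain
  -- `ℝ`, ready for dominated convergence.
  have hscale : ∀ᶠ m : ℝ in atTop, ((m * √m : ℝ) : ℂ) * ∫ θ in -π..π, F m θ =
      ∫ y : ℝ, (Set.Ioc (-(π * (m * √m))) (π * (m * √m))).indicator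
        (fun y => F m (y / (m * √m))) y := by
    filter_upwards [eventually_gt_atTop 0] with m hm
    have hw : 0 < m * √m := mul_pos hm (sqrt_pos.2 hm)
    rw [MeasureTheory.integral_indicator measurableSet_Ioc, ← integral_of_le (by nlinarith [pi_pos]),
      intervalIntegral.integral_comp_div _ hw.ne', Complex.real_smul, neg_div,
      mul_div_cancel_right₀ _ hw.ne']
  have hlim : ∫ y : ℝ, Complex.exp ((-(t ^ 3 * scaledVar (b * t) / 2) * y ^ 2 : ℝ)) =
      ((√(2 * π / (t ^ 3 * scaledVar (b * t))) : ℝ) : ℂ) := by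
    simp only [← Complex.ofReal_exp]
    rw [integral_complex_ofReal, integral_gaussian]
    congr 2
    have := scaledVar_pos (b * t)
    field_simp
  rw [← hlim]
  refine Tendsto.congr' (EventuallyEq.symm hscale) ?_
  refine tendsto_integral_filter_of_dominated_convergence (fun y => (1 + a * y ^ 2)⁻¹)
    ?_ ?_ (integrable_inv_one_add_mul_sq ha) (ae_of_all _ fun y => ?_)
  · refine Eventually.of_forall fun m => ?_
    have : Continuous fun y => F m (y / (m * √m)) := (hFc m).comp (continuous_id.div_const _)
    exact this.aestronglyMeasurable.indicator measurableSet_Ioc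
  · filter_upwards [eventually_ge_atTop (2 / t)] with m hm
    refine ae_of_all _ fun y => ?_
    rw [norm_indicator_eq_indicator_norm]
    refine Set.indicator_apply_le' (fun hy => ?_) (fun _ => by positivity)
    rw [hnorm]
    refine hbound m ?_ y (abs_le.2 ⟨hy.1.le, hy.2⟩)
    rw [div_le_iff₀ ht] at hm
    linarith
  · refine (tendsto_charProd b ht hb y).congr' ?_
    have hw : Tendsto (fun m : ℝ => π * (m * √m)) atTop atTop :=
      (tendsto_id.atTop_mul_atTop₀ tendsto_sqrt_atTop).const_mul_atTop pi_pos
    filter_upwards [hw.eventually_gt_atTop |y|] with m hm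
    have hmem : y ∈ Set.Ioc (-(π * (m * √m))) (π * (m * √m)) :=
      ⟨(abs_lt.1 hm).1, (abs_lt.1 hm).2.le⟩
    rw [Set.indicator_of_mem hmem]

/-! ### Asymptotics of the product and assembly. -/

theorem contDiff_log_one_add_exp (b : ℝ) :
    ContDiff ℝ 2 fun u : ℝ => log (1 + exp (-(b * u))) :=
  (contDiff_const.add (contDiff_const.mul contDiff_id).neg.exp).log fun u => by positivity

/-- Integration by parts. When the last integral is `1` this contributes one `b` to the exponent;
the other `b` of `B(t)` comes from `x^{-n} = e^{b√n}`. -/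
theorem integral_log_one_add_exp (b t : ℝ) :
    ∫ u in (0 : ℝ)..t, log (1 + exp (-(b * u))) =
      t * log (1 + exp (-(b * t))) + b * ∫ u in (0 : ℝ)..t, u * sigmoid (-(b * u)) := by
  have hd : ∀ u ∈ Set.uIcc (0 : ℝ) t, HasDerivAt (fun u : ℝ => u * log (1 + exp (-(b * u))))
      (log (1 + exp (-(b * u))) - b * (u * sigmoid (-(b * u)))) u := fun u _ => by
    have h1 : HasDerivAt (fun u : ℝ => -(b * u)) (-(b * 1)) u :=
      ((hasDerivAt_id u).const_mul b).neg
    have h2 := (hasDerivAt_id u).mul ((h1.exp.const_add 1).log (by positivity))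
    convert! h2 using 1
    rw [← exp_div_one_add_exp]
    simp only [id]
    ring
  have hI1 := (contDiff_log_one_add_exp b).continuous.intervalIntegrable (μ := volume) 0 t
  have hI2 := ((continuous_mul_sigmoid b).intervalIntegrable (μ := volume) 0 t).const_mul b
  have := integral_eq_sub_of_hasDerivAt hd (hI1.sub hI2)
  rw [intervalIntegral.integral_sub hI1 hI2, intervalIntegral.integral_const_mul] at this
  simp only [zero_mul, sub_zero] at this
  linarith

theorem tendsto_sqrt_natCast : Tendsto (fun n : ℕ => √(n : ℝ)) atTop atTop :=
  tendsto_sqrt_atTop.comp tendsto_natCast_atTop_atTop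

theorem tendsto_distinctCount (b : ℝ) {t : ℝ} (ht : 0 < t)
    (hb : ∫ u in (0 : ℝ)..t, u * sigmoid (-(b * u)) = 1) :
    Tendsto (fun n : ℕ => √(n : ℝ) * √√(n : ℝ) * (2 * π * (distinctCount t n *
      exp (-(b * √(n : ℝ))))) /
        ∏ k ∈ Finset.Icc 1 ⌊t * √(n : ℝ)⌋₊, (1 + exp (-(b * (k / √(n : ℝ)))))) atTop
      (𝓝 √(2 * π / (t ^ 3 * scaledVar (b * t)))) := by
  have h := (tendsto_integral_charProd b ht hb).comp tendsto_sqrt_natCast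
  have hre := (Complex.continuous_re.tendsto _).comp h
  rw [Complex.ofReal_re] at hre
  refine hre.congr' ?_
  filter_upwards [eventually_ne_atTop 0] with n hn
  have key := distinctCount_mul_exp_eq ht.le b hn
  simp only [Function.comp, sq_sqrt (Nat.cast_nonneg (α := ℝ) n)]
  have hP : (∏ k ∈ Finset.Icc 1 ⌊t * √(n : ℝ)⌋₊, (1 + exp (-(b * (k / √(n : ℝ)))))) ≠ 0 :=
    Finset.prod_ne_zero_iff.2 fun k _ => by positivity
  set P := ∏ k ∈ Finset.Icc 1 ⌊t * √(n : ℝ)⌋₊, (1 + exp (-(b * (k / √(n : ℝ)))))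
  have hPC := Complex.ofReal_ne_zero.2 hP
  rw [mul_comm (P : ℂ), ← div_eq_iff hPC] at key
  rw [← key, ← Complex.ofReal_re (_ / P)]
  congr 1
  push_cast
  ring

/-- Exponentiated Euler–Maclaurin: the limit is the boundary term `(f(t) - f(0))/2` with `f(u) = log
(1 + e^{-bu})`, so `f(0) = log 2`. -/
theorem tendsto_prod_one_add_exp (b : ℝ) {t : ℝ} (ht : 0 < t)
    (hb : ∫ u in (0 : ℝ)..t, u * sigmoid (-(b * u)) = 1) :
    Tendsto (fun n : ℕ => (∏ k ∈ Finset.Icc 1 ⌊t * √(n : ℝ)⌋₊, (1 + exp (-(b * (k / √(n : ℝ)))))) *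
      exp (Int.fract (t * √(n : ℝ)) * log (1 + exp (-(b * t))) -
        √(n : ℝ) * (t * log (1 + exp (-(b * t))) + b))) atTop
      (𝓝 √((1 + exp (-(b * t))) / 2)) := by
  have h := (tendsto_sum_sub_integral (contDiff_log_one_add_exp b) ht).comp tendsto_sqrt_natCast
  have h2 := (continuous_exp.tendsto _).comp
    (h.add_const ((log (1 + exp (-(b * t))) - log 2) / 2))
  have hval : exp (0 + (log (1 + exp (-(b * t))) - log 2) / 2) = √((1 + exp (-(b * t))) / 2) := by
    rw [zero_add, ← log_div (by positivity) two_ne_zero, exp_half, exp_log (by positivity)]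
  rw [hval] at h2
  refine h2.congr fun n => ?_
  have hprod : ∏ k ∈ Finset.Icc 1 ⌊t * √(n : ℝ)⌋₊, (1 + exp (-(b * (k / √(n : ℝ))))) =
      exp (∑ k ∈ Finset.Icc 1 ⌊t * √(n : ℝ)⌋₊, log (1 + exp (-(b * (k / √(n : ℝ)))))) := by
    rw [exp_sum]
    exact Finset.prod_congr rfl fun k _ => (exp_log (by positivity)).symm
  simp only [Function.comp]
  rw [hprod, ← exp_add, integral_log_one_add_exp, hb]
  congr 1
  norm_num
  ring

/-- After squaring, this is `(e^{c/2} + e^{-c/2})² σ(-c) = 1 + e^{-c}` with `c = βt`, the factor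
`σ(-c)` being supplied by `β'`. -/
theorem amplitude_eq {t : ℝ} (ht : √2 < t) :
    2 * π * ((exp (beta t * t / 2) + exp (-(beta t * t / 2))) / 2 * √(deriv beta t / (π * t))) =
      √(2 * π / (t ^ 3 * scaledVar (beta t * t))) * √((1 + exp (-(beta t * t))) / 2) := by
  have h0 := zero_lt_of_sqrt_two_lt ht
  rw [deriv_beta ht]
  set c := beta t * t
  have hV := scaledVar_pos c
  have hE := exp_pos (c / 2)
  have hc : exp (-c) = (exp (c / 2) ^ 2)⁻¹ := by
    rw [← exp_nat_mul, ← exp_neg]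
    push_cast
    ring_nf
  rw [← sq_eq_sq₀ (by positivity) (by positivity)]
  have hσ := sigmoid_pos (-c)
  rw [mul_pow, mul_pow, mul_pow, mul_pow √_, sq_sqrt (by positivity), sq_sqrt (by positivity),
    sq_sqrt (by positivity), ← exp_div_one_add_exp, hc, exp_neg (c / 2)]
  field_simp

theorem isEquivalent_distinctCount {t : ℝ} (ht : √2 < t) :
    Asymptotics.IsEquivalent atTop (fun n : ℕ => (distinctCount t n : ℝ))
      (fun n : ℕ => Afun n t / (n : ℝ) ^ (3 / 4 : ℝ) * exp (Bfun t * √(n : ℝ))) := by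
  have h0 := zero_lt_of_sqrt_two_lt ht
  set K := (exp (beta t * t / 2) + exp (-(beta t * t / 2))) / 2 * √(deriv beta t / (π * t)) with hK
  have hK0 : 0 < K := by
    have := deriv_beta_pos ht
    positivity
  have hlim := ((tendsto_distinctCount (beta t) h0 (integral_beta ht)).mul
    (tendsto_prod_one_add_exp (beta t) h0 (integral_beta ht))).div_const (2 * π * K)
  rw [← amplitude_eq ht, ← hK, div_self (by positivity)] at hlim
  refine Asymptotics.isEquivalent_of_tendsto_one (hlim.congr' ?_)
  filter_upwards [eventually_gt_atTop 0] with n hn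
  have hm : 0 < √(n : ℝ) := sqrt_pos.2 (by exact_mod_cast hn)
  have hmm : 0 < √√(n : ℝ) := sqrt_pos.2 hm
  have hpow : (n : ℝ) ^ (3 / 4 : ℝ) = √(n : ℝ) * √√(n : ℝ) := by
    rw [sqrt_eq_rpow, sqrt_eq_rpow, ← rpow_mul (Nat.cast_nonneg n),
      ← rpow_add (by exact_mod_cast hn)]
    norm_num
  have hA : Afun n t = K * exp (-(Int.fract (t * √(n : ℝ)) * log (1 + exp (-(beta t * t))))) := by
    rw [Afun, neg_mul, rpow_def_of_pos (by positivity), mul_comm (log _), hK]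
    generalize Int.fract (t * √(n : ℝ)) * log (1 + exp (-(beta t * t))) = x
    rw [exp_neg x]
    field_simp
  have hP : (∏ k ∈ Finset.Icc 1 ⌊t * √(n : ℝ)⌋₊, (1 + exp (-(beta t * (k / √(n : ℝ)))))) ≠ 0 :=
    Finset.prod_ne_zero_iff.2 fun k _ => by positivity
  simp only [Pi.div_apply]
  rw [hA, hpow, Bfun, neg_mul]
  generalize (∏ k ∈ Finset.Icc 1 ⌊t * √(n : ℝ)⌋₊, (1 + exp (-(beta t * (k / √(n : ℝ)))))) = P at *
  generalize Int.fract (t * √(n : ℝ)) * log (1 + exp (-(beta t * t))) = x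
  rw [eq_div_iff (by positivity)]
  -- The tilt, the product asymptotics and the claimed main term cancel exactly, including the
  -- oscillating factor.
  have hexp : exp (-(beta t * √(n : ℝ))) *
      exp (x - √(n : ℝ) * (t * log (1 + exp (-(beta t * t))) + beta t)) *
      (exp (-x) * exp ((2 * beta t + t * log (1 + exp (-(beta t * t)))) * √(n : ℝ))) = 1 := by
    rw [← exp_add, ← exp_add, ← exp_add, exp_eq_one_iff]
    ring
  calc _ = (distinctCount t n : ℝ) * (exp (-(beta t * √(n : ℝ))) *
      exp (x - √(n : ℝ) * (t * log (1 + exp (-(beta t * t))) + beta t)) *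
      (exp (-x) * exp ((2 * beta t + t * log (1 + exp (-(beta t * t)))) * √(n : ℝ)))) := by
        field_simp
    _ = _ := by rw [hexp, mul_one]

end DistinctPartitions

theorem theorem1 (t : ℝ) (ht : √2 < t) :
    -- `β` is well defined on `(√2, ∞)`, with values in `(-∞, π / (2√3))`
    (∀ s : ℝ, √2 < s →
      IsBeta s (beta s) ∧ (∀ b : ℝ, IsBeta s b → b = beta s) ∧
        beta s < Real.pi / (2 * √3)) ∧
    -- `β'(t)` exists and is positive, so that `A_n(t)` is meaningful
    DifferentiableAt ℝ beta t ∧ 0 < deriv beta t ∧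
    -- the asymptotic formula
    Asymptotics.IsEquivalent Filter.atTop
      (fun n : ℕ => (distinctCount t n : ℝ))
      (fun n : ℕ => Afun n t / (n : ℝ) ^ (3 / 4 : ℝ) * Real.exp (Bfun t * √(n : ℝ))) := by
  exact ⟨fun s hs => ⟨isBeta_beta hs, fun b hb => eq_beta_of_isBeta hs hb, beta_lt hs⟩,
    (hasDerivAt_beta ht).differentiableAt, deriv_beta_pos ht, isEquivalent_distinctCount ht⟩
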